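/- **Setting.** There are $K$ cells and $U$ agents. An action is a vector $a\in\{0,1,\dots,U\}^K$ ($a_k=u\ge 1$: agent $u$ searches cell $k$; $a_k=0$: cell $k$ is not searched) such that $a_i=a_j=u\ge 1$ with $i<j$ implies $a_k=u$ for all $i\le k\le j$; $\mathcal A$ is the set of actions. Known scaling functions $\phi_u:\mathcal A\to[0,1]$ ($1\le u\le U$) are given. The unknown parameters are rates $\lambda_k>0$ and baseline detection probabilities $\omega_{ku}\in(0,1]$; put $\gamma_k(a)=\sum_{u}\phi_u(a)\,\omega_{ku}\,\mathbb 1\{a_k=u\}$ and $\tau_{ku}=\omega_{ku}\lambda_k$, so that $\tau$ ranges over all of $(0,\infty)^{KU}$. In round $t=1,2,\dots$ a (possibly randomised) policy $\pi$ chooses $a_t\in\mathcal A$ from the history $(a_1,Y_1,\dots,a_{t-1},Y_{t-1})$; then, independently over the cells $k$ and given the past only through $a_t$, $X_{kt}\sim\mathrm{Pois}(\lambda_k)$ events occur and $Y_{kt}\mid X_{kt}\sim\mathrm{Bin}(X_{kt},\gamma_k(a_t))$ of them are observed, $Y_t=(Y_{kt})_k$. With $r(a)=\sum_k\gamma_k(a)\lambda_k$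 the regret is $$\mathrm{Reg}^\pi_{\lambda,\gamma}(n)=n\max_{a\in\mathcal A}r(a)-\mathbb E\Big(\sum_{t=1}^n r(a_t)\Big).$$ **Notation.** For $a\in\mathcal A$ let $g(a)\in[0,1]^{KU}$ be given by $g(a)_{ku}=\phi_u(a)\,\mathbb 1\{a_k=u\}$, and let $\mathcal G=\{g(a):a\in\mathcal A\}$. For $\tau\in(0,\infty)^{KU}$ and $g\in\mathcal G$ write $g\cdot\tau=\sum_{k,u}g_{ku}\tau_{ku}$, $\mathrm{opt}_\tau=\max_{g\in\mathcal G}g\cdot\tau$, $\Delta_g=\mathrm{opt}_\tau-g\cdot\tau$, and $$\tilde J(\tau)=\{g\in\mathcal G: g\cdot\tau=\mathrm{opt}_\tau\},\quad \tilde S(\tau)=\mathcal G\setminus\tilde J(\tau),\quad \tilde{\mathcal I}(\tau)=\{(k,u):\exists g\in\tilde J(\tau),\ g_{ku}>0\},$$ $$\tilde B(\tau)=\{\theta\in(0,\infty)^{KU}:\ g\cdot\theta<\mathrm{opt}_\theta\ \ \forall g\in\tilde J(\tau),\ \text{ and }\ \theta_{ku}=\tau_{ku}\ \ \forall (k,u)\in\tilde{\mathcal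 I}(\tau)\}.$$ A policy is uniformly good (for the given $\phi$) if for all parameters $(\lambda,\omega)$ as above, all $g\in\mathcal G$ with $\Delta_g>0$ and all $\alpha>0$, $\mathbb E\big(\sum_{t=1}^n\mathbb 1\{g(a_t)=g\}\big)=o(n^\alpha)$ as $n\to\infty$. **Statement.** Let $\lambda\in(0,\infty)^K$ and $\omega\in(0,1]^{KU}$ be such that $\tau=(\omega_{ku}\lambda_k)_{k,u}$ satisfies $\tilde B(\tau)\ne\emptyset$. Then every uniformly good policy $\pi$ satisfies $$\liminf_{n\to\infty}\frac{\mathrm{Reg}^\pi_{\lambda,\gamma}(n)}{\log n}\ \ge\ \tilde c(\tau),$$ where $\tilde c(\tau)$ is the optimal value of the problem $$\inf_{d\ge 0}\ \sum_{g\in\tilde S(\tau)}d_g\,\Delta_g\quad\text{subject to}\quad \inf_{\theta\in\tilde B(\tau)}\ \sum_{g\in\tilde S(\tau)}d_g\sum_{k=1}^K\sum_{u=1}^U g_{ku}\,\mathrm{kl}(\tau_{ku},\theta_{ku})\ \ge\ 1,$$ with $\mathrm{kl}(x,y)=x\log(x/y)+y-x$. -/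

import Mathlib

open scoped NNReal

noncomputable section

namespace Surveillance

/-- Allocations of `U` agents to `K` cells (`some u`: the cell is searched by agent `u`; `none`: it
goes unsearched) in which the cells searched by any one agent form an interval. -/
def actionSet (K U : ℕ) : Set (Fin K → Option (Fin U)) :=
  {a | ∀ (i j : Fin K) (u : Fin U), i < j → a i = some u → a j = some u →
    ∀ k, i ≤ k → k ≤ j → a k = some u}

abbrev Action (K U : ℕ) : Type := ↥(actionSet K U)

/-- Scaling functions `φ_u : 𝒜 → [0, 1]`, known to the decision-maker. -/
abbrev Scaling (K U : ℕ) : Type := Fin U → Action K U → unitInterval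

/-- The unknown parameters: arrival rates `λ_k > 0` and baseline detection probabilities
`ω_{ku} ∈ (0, 1]`. -/
structure Env (K U : ℕ) where
  rate : Fin K → ℝ≥0
  rate_pos : ∀ k, 0 < rate k
  base : Fin K → Fin U → unitInterval
  base_pos : ∀ k u, 0 < base k u

/-- One round of the interaction: the action taken and the numbers of events observed. -/
abbrev Round (K U : ℕ) : Type := Action K U × (Fin K → ℕ)

/-- A (possibly randomised) policy: it maps the history, listed with the most recent round first,
to the law of the next action. A deterministic policy takes values of the form `PMF.pure a`. -/
abbrev Policy (K U : ℕ) : Type := List (Round K U) → PMF (Action K U)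

variable {K U : ℕ}

namespace Env

/-- `τ_{ku} = ω_{ku} λ_k`. -/
def tau (e : Env K U) (k : Fin K) (u : Fin U) : ℝ := (e.base k u : ℝ) * (e.rate k : ℝ)

/-- The detection probability `γ_k(a) = ∑_u φ_u(a) ω_{ku} 𝟙{a_k = u}`. -/
def gamma (e : Env K U) (φ : Scaling K U) (a : Action K U) (k : Fin K) : unitInterval :=
  match a.1 k with
  | none => 0
  | some u => φ u a * e.base k u

/-- The law of the number of events observed in cell `k` in a round in which `a` is played: the
number of events is `X ∼ Pois(λ_k)`, and given `X` the observed number is `Bin(X, γ_k(a))`. -/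
def cellLaw (e : Env K U) (φ : Scaling K U) (a : Action K U) (k : Fin K) : PMF ℕ :=
  (ProbabilityTheory.poissonMeasure (e.rate k)).toPMF.bind fun x =>
    (ProbabilityTheory.binomial x (e.gamma φ a k)).toPMF

/-- The law of the vector of observations under action `a`; the cells are independent. -/
def obsLaw (e : Env K U) (φ : Scaling K U) (a : Action K U) : PMF (Fin K → ℕ) :=
  (MeasureTheory.Measure.pi fun k => (e.cellLaw φ a k).toMeasure).toPMF

/-- The law of the history of the first `n` rounds under the policy `π`. -/
def histLaw (e : Env K U) (φ : Scaling K U) (π : Policy K U) : ℕ → PMF (List (Round K U))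
  | 0 => PMF.pure []
  | n + 1 => (e.histLaw φ π n).bind fun h => (π h).bind fun a =>
      (e.obsLaw φ a).map fun y => (a, y) :: h

/-- `𝔼 (∑_{t=1}^n f(a_t))` under the policy `π`. -/
def expSum (e : Env K U) (φ : Scaling K U) (π : Policy K U) (f : Action K U → ℝ) (n : ℕ) : ℝ :=
  ∑' h : List (Round K U), (e.histLaw φ π n h).toReal * (h.map fun x => f x.1).sum

/-- The mean number `γ(a)ᵀ λ` of events observed under action `a`. -/
def reward (e : Env K U) (φ : Scaling K U) (a : Action K U) : ℝ :=
  ∑ k, (e.gamma φ a k : ℝ) * (e.rate k : ℝ)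

/-- The regret `n · max_a r(a) - 𝔼 (∑_{t=1}^n r(a_t))`. -/
def regret (e : Env K U) (φ : Scaling K U) (π : Policy K U) (n : ℕ) : ℝ :=
  n * (⨆ a : Action K U, e.reward φ a) - e.expSum φ π (e.reward φ) n

end Env

/-- The matrix `g(a)` of filtering probabilities of the searcher-cell pairs under action `a`. -/
def filterVec (φ : Scaling K U) (a : Action K U) (k : Fin K) (u : Fin U) : ℝ :=
  if a.1 k = some u then (φ u a : ℝ) else 0

/-- The set `𝒢` of all filtering matrices. -/
def filterVecs (φ : Scaling K U) : Finset (Fin K → Fin U → ℝ) :=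
  (Set.finite_range (filterVec φ)).toFinset

/-- The expected reward `g ⬝ τ`. -/
def value (τ g : Fin K → Fin U → ℝ) : ℝ := ∑ k, ∑ u, g k u * τ k u

/-- The optimal expected reward for the parameter `τ`. -/
def opt (φ : Scaling K U) (τ : Fin K → Fin U → ℝ) : ℝ :=
  ⨆ a : Action K U, value τ (filterVec φ a)

/-- The optimality gap `Δ_g`. -/
def gap (φ : Scaling K U) (τ g : Fin K → Fin U → ℝ) : ℝ := opt φ τ - value τ g

open Classical in
/-- The set `J` of optimal filtering matrices. -/
def optimal (φ : Scaling K U) (τ : Fin K → Fin U → ℝ) : Finset (Fin K → Fin U → ℝ) :=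
  (filterVecs φ).filter fun g => value τ g = opt φ τ

open Classical in
/-- The set `S = 𝒢 \ J` of suboptimal filtering matrices. -/
def suboptimal (φ : Scaling K U) (τ : Fin K → Fin U → ℝ) : Finset (Fin K → Fin U → ℝ) :=
  filterVecs φ \ optimal φ τ

/-- The set `I` of the searcher-cell pairs that are used in at least one optimal action. -/
def optimalPairs (φ : Scaling K U) (τ : Fin K → Fin U → ℝ) : Set (Fin K × Fin U) :=
  {p | ∃ g ∈ optimal φ τ, 0 < g p.1 p.2}

/-- The set `B`: the positive parameters `θ` for which every element of `J(τ)` is suboptimal, but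
which agree with `τ` on all pairs used by optimal actions. -/
def altSet (φ : Scaling K U) (τ : Fin K → Fin U → ℝ) : Set (Fin K → Fin U → ℝ) :=
  {θ | (∀ k u, 0 < θ k u) ∧ (∀ g ∈ optimal φ τ, value θ g < opt φ θ) ∧
    ∀ p ∈ optimalPairs φ τ, θ p.1 p.2 = τ p.1 p.2}

/-- The Kullback-Leibler divergence of the Poisson laws with means `x, y > 0`. -/
def kl (x y : ℝ) : ℝ := x * Real.log (x / y) + y - x

/-- The divergence of the laws of an observation under `τ` and `θ` when `g` is played. -/
def info (τ θ g : Fin K → Fin U → ℝ) : ℝ := ∑ k, ∑ u, g k u * kl (τ k u) (θ k u)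

/-- The feasible points of the optimisation problem that defines the lower bound (for nonempty
`B`, an infimum over `B` is at least `1` iff all its terms are). -/
def feasible (φ : Scaling K U) (τ : Fin K → Fin U → ℝ) : Set ((Fin K → Fin U → ℝ) → ℝ) :=
  {d | (∀ g, 0 ≤ d g) ∧ ∀ θ ∈ altSet φ τ, 1 ≤ ∑ g ∈ suboptimal φ τ, d g * info τ θ g}

/-- The optimal value `c(τ) = inf ∑_{g ∈ S} d_g Δ_g` over the feasible `d`. -/
def lowerConst (φ : Scaling K U) (τ : Fin K → Fin U → ℝ) : EReal :=
  ⨅ d ∈ feasible φ τ, ((∑ g ∈ suboptimal φ τ, d g * gap φ τ g : ℝ) : EReal)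

open Classical in
/-- A policy is uniformly good if, whatever the unknown parameters are, every suboptimal `g ∈ 𝒢`
is played `o(n ^ α)` times in expectation in the first `n` rounds, for all `α > 0`. -/
def UniformlyGood (φ : Scaling K U) (π : Policy K U) : Prop :=
  ∀ e : Env K U, ∀ g ∈ filterVecs φ, 0 < gap φ e.tau g → ∀ α : ℝ, 0 < α →
    (fun n : ℕ => e.expSum φ π (fun a => if filterVec φ a = g then 1 else 0) n)
      =o[Filter.atTop] fun n : ℕ => (n : ℝ) ^ α

end Surveillance

end

open scoped NNReal

noncomputable section

namespace Surveillance

/-! ### Histories of a policy facing arbitrary observation laws. -/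

section Interaction

open scoped ENNReal

variable {A Y : Type*}

/-! This is a Graves–Lai change-of-measure argument. Fix an alternative `θ`. It agrees with `τ` on
all pairs used by optimal actions, so only suboptimal plays yield information separating the two:
the expected log-likelihood ratio of `n` rounds is the sum over suboptimal `g` of play count times
`info τ θ g` (Wald's identity, `hasSum_histDist_mul_sum`). Uniform goodness forces the fraction of
rounds spent in `J(τ)` to tend to 1 under `τ`, while under `θ` it is `o(n ^ (α - 1))`, since `J(τ)`
is suboptimal there. The transportation inequality `mul_tsum_sub_exp_mul_tsum_le` turns this
contrast into information of at least about `(1 - α) log n`.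

Hence any limit point of the play counts divided by `log n` is feasible
(`UniformlyGood.one_le_sum`). The regret is the gap-weighted sum of these counts
(`Env.regret_eq_sum`), so if it stayed below `c log n` along infinitely many `n`, compactness would
give a feasible point of cost at most `c`. -/

theorem hasSum_toReal_mul_sub {α : Type*} {p P N : α → ℝ≥0∞}
    (hP : ∑' a, p a * P a ≠ ∞) (hN : ∑' a, p a * N a ≠ ∞) :
    HasSum (fun a => (p a).toReal * ((P a).toReal - (N a).toReal))
      ((∑' a, p a * P a).toReal - (∑' a, p a * N a).toReal) := by
  have h1 := ENNReal.hasSum_toReal hP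
  have h2 := ENNReal.hasSum_toReal hN
  rw [← ENNReal.tsum_toReal_eq (ENNReal.ne_top_of_tsum_ne_top hP)] at h1
  rw [← ENNReal.tsum_toReal_eq (ENNReal.ne_top_of_tsum_ne_top hN)] at h2
  simpa [ENNReal.toReal_mul, mul_sub] using h1.sub h2

/-- The law of the history of `n` rounds in which actions follow `π` and observations `obs`. -/
def histDist (π : List (A × Y) → PMF A) (obs : A → PMF Y) : ℕ → PMF (List (A × Y))
  | 0 => PMF.pure []
  | n + 1 => (histDist π obs n).bind fun h => (π h).bind fun a =>
      (obs a).map fun y => (a, y) :: h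

variable (π : List (A × Y) → PMF A) (obs : A → PMF Y)

theorem histDist_succ_nil (n : ℕ) : histDist π obs (n + 1) [] = 0 := by
  simp [histDist, PMF.bind_apply, PMF.map_apply]

theorem histDist_succ_cons (n : ℕ) (a : A) (y : Y) (h : List (A × Y)) :
    histDist π obs (n + 1) ((a, y) :: h) = histDist π obs n h * (π h a * obs a y) := by
  classical
  simp only [histDist, PMF.bind_apply, PMF.map_apply, List.cons.injEq, Prod.mk.injEq]
  rw [tsum_eq_single h, tsum_eq_single a, tsum_eq_single y]
  · simp
  · intro y' hy'; simp [hy'.symm]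
  · intro a' ha'; simp [ha'.symm]
  · intro h' hh'; simp [hh'.symm]

theorem length_of_histDist_ne_zero {n : ℕ} {h : List (A × Y)} (hh : histDist π obs n h ≠ 0) :
    h.length = n := by
  induction n generalizing h with
  | zero =>
    have : h = [] := by simpa [histDist, PMF.pure_apply] using hh
    simp [this]
  | succ n ih =>
    match h with
    | [] => exact absurd (histDist_succ_nil π obs n) hh
    | (a, y) :: h =>
      rw [histDist_succ_cons] at hh
      simp [ih (left_ne_zero_of_mul hh)]

/-- Prepending a round is injective and misses only the empty history, which has probability zero
after `n + 1` rounds. -/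
theorem tsum_histDist_succ_mul (n : ℕ) (f : List (A × Y) → ℝ≥0∞) :
    ∑' h, histDist π obs (n + 1) h * f h =
      ∑' h, histDist π obs n h * ∑' a, π h a * ∑' y, obs a y * f ((a, y) :: h) := by
  let c : List (A × Y) × A × Y → List (A × Y) := fun x => (x.2.1, x.2.2) :: x.1
  have hc : Function.Injective c := by
    rintro ⟨h, a, y⟩ ⟨h', a', y'⟩ hx
    simp only [c, List.cons.injEq, Prod.mk.injEq] at hx
    simp [hx]
  rw [← hc.tsum_eq (f := fun h => histDist π obs (n + 1) h * f h), ENNReal.tsum_prod']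
  · refine tsum_congr fun h => ?_
    rw [ENNReal.tsum_prod', ← ENNReal.tsum_mul_left]
    refine tsum_congr fun a => ?_
    rw [← ENNReal.tsum_mul_left, ← ENNReal.tsum_mul_left]
    refine tsum_congr fun y => ?_
    simp only [c, histDist_succ_cons, mul_assoc]
  · intro h hh
    match h with
    | [] => simp [histDist_succ_nil] at hh
    | (a, y) :: h => exact ⟨(h, a, y), rfl⟩

/-- Wald's identity: each observation may be replaced by its mean given the action. -/
theorem tsum_histDist_mul_sum (F : A × Y → ℝ≥0∞) (n : ℕ) :
    ∑' h, histDist π obs n h * (h.map F).sum =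
      ∑' h, histDist π obs n h * (h.map fun x => ∑' y, obs x.1 y * F (x.1, y)).sum := by
  induction n with
  | zero =>
    refine tsum_congr fun h => ?_
    by_cases hh : h = [] <;> simp [histDist, PMF.pure_apply, hh]
  | succ n ih =>
    simp only [tsum_histDist_succ_mul, List.map_cons, List.sum_cons, mul_add, ENNReal.tsum_add,
      ENNReal.tsum_mul_right, PMF.tsum_coe, one_mul, ih]

theorem tsum_histDist_mul_sum_ne_top [Finite A] {m : A → ℝ≥0∞} (hm : ∀ a, m a ≠ ∞) (n : ℕ) :
    ∑' h, histDist π obs n h * (h.map fun x => m x.1).sum ≠ ∞ := by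
  cases nonempty_fintype A
  have hC : ∑ a, m a ≠ ∞ := ENNReal.sum_ne_top.2 fun a _ => hm a
  refine ne_top_of_le_ne_top (b := n * ∑ a, m a) (ENNReal.mul_ne_top (by simp) hC) ?_
  calc _ ≤ ∑' h, histDist π obs n h * (n * ∑ a, m a) := ENNReal.tsum_le_tsum fun h => ?_
    _ = _ := by rw [ENNReal.tsum_mul_right, PMF.tsum_coe, one_mul]
  by_cases hh : histDist π obs n h = 0
  · simp [hh]
  gcongr
  have := List.sum_le_card_nsmul (h.map fun x => m x.1) (∑ a, m a) (by
    simp only [List.mem_map]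
    rintro _ ⟨x, -, rfl⟩
    exact Finset.single_le_sum (f := m) (fun _ _ => zero_le) (Finset.mem_univ x.1))
  simpa [length_of_histDist_ne_zero π obs hh] using this

theorem toReal_sum_sub_toReal_sum {X : Type*} (P N : X → ℝ≥0∞) (h : List X)
    (hP : ∀ x ∈ h, P x ≠ ∞) (hN : ∀ x ∈ h, N x ≠ ∞) :
    (h.map P).sum.toReal - (h.map N).sum.toReal =
      (h.map fun x => (P x).toReal - (N x).toReal).sum := by
  have key : ∀ (Q : X → ℝ≥0∞) (h : List X), (∀ x ∈ h, Q x ≠ ∞) →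
      (h.map Q).sum ≠ ∞ ∧ (h.map Q).sum.toReal = (h.map fun x => (Q x).toReal).sum := by
    intro Q h hQ
    induction h with
    | nil => simp
    | cons x h ih =>
      obtain ⟨h1, h2⟩ := ih fun z hz => hQ z (List.mem_cons_of_mem _ hz)
      have h3 := hQ x List.mem_cons_self
      simp [h1, h2, h3, ENNReal.toReal_add]
  rw [(key P h hP).2, (key N h hN).2, ← Multiset.sum_coe, ← Multiset.sum_coe, ← Multiset.sum_coe,
    ← Multiset.map_coe, ← Multiset.map_coe, ← Multiset.map_coe, Multiset.sum_map_sub]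

/-- Wald's identity for signed `F`, from the `ℝ≥0∞` version applied to the positive and negative
parts. Finiteness of `A` bounds the conditional means uniformly, so no `∞ - ∞` arises. -/
theorem hasSum_histDist_mul_sum [Finite A] {F : A × Y → ℝ} {m : A → ℝ}
    (hF : ∀ a, HasSum (fun y => (obs a y).toReal * F (a, y)) (m a)) (n : ℕ) :
    HasSum (fun h => (histDist π obs n h).toReal * (h.map F).sum)
      (∑' h, (histDist π obs n h).toReal * (h.map fun x => m x.1).sum) := by
  set P : A × Y → ℝ≥0∞ := fun x => ENNReal.ofReal (F x)
  set N : A × Y → ℝ≥0∞ := fun x => ENNReal.ofReal (-F x)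
  have hPN : ∀ x, (P x).toReal - (N x).toReal = F x := fun x => by
    simp only [P, N, ENNReal.toReal_ofReal']
    rcases le_total (F x) 0 with h | h
    · rw [max_eq_right h, max_eq_left (by linarith)]; ring
    · rw [max_eq_left h, max_eq_right (by linarith)]; ring
  have fin : ∀ (Q : A × Y → ℝ≥0∞), (∀ x, Q x ≤ ENNReal.ofReal |F x|) → ∀ a,
      ∑' y, obs a y * Q (a, y) ≠ ∞ := by
    intro Q hQ a
    have h := (hF a).summable.abs.tsum_ofReal_ne_top
    refine ne_top_of_le_ne_top h (ENNReal.tsum_le_tsum fun y => ?_)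
    rw [abs_mul, ENNReal.ofReal_mul (abs_nonneg _), ENNReal.abs_toReal,
      ENNReal.ofReal_toReal ((obs a).apply_ne_top y)]
    gcongr
    exact hQ _
  have finP := fin P fun x => ENNReal.ofReal_le_ofReal (le_abs_self _)
  have finN := fin N fun x => ENNReal.ofReal_le_ofReal (neg_le_abs _)
  have hm : ∀ a, (∑' y, obs a y * P (a, y)).toReal - (∑' y, obs a y * N (a, y)).toReal = m a := by
    intro a
    have := hasSum_toReal_mul_sub (finP a) (finN a)
    simp only [hPN] at this
    exact this.unique (hF a)
  have tP := tsum_histDist_mul_sum_ne_top π obs finP n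
  have tN := tsum_histDist_mul_sum_ne_top π obs finN n
  have h1 := hasSum_toReal_mul_sub tP tN
  rw [← tsum_histDist_mul_sum π obs P] at tP h1
  rw [← tsum_histDist_mul_sum π obs N] at tN h1
  have h2 := hasSum_toReal_mul_sub tP tN
  simp_rw [toReal_sum_sub_toReal_sum P N _ (fun _ _ => ENNReal.ofReal_ne_top)
    (fun _ _ => ENNReal.ofReal_ne_top), hPN] at h2
  simp_rw [toReal_sum_sub_toReal_sum _ _ _ (fun (x : A × Y) _ => finP x.1) (fun x _ => finN x.1),
    hm] at h1
  rwa [h1.tsum_eq]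

/-- The likelihood ratio of two histories under the same policy. -/
theorem histDist_eq_mul_exp {obs' : A → PMF Y} {F : A × Y → ℝ}
    (hF : ∀ a y, obs' a y = obs a y * ENNReal.ofReal (Real.exp (-F (a, y)))) (n : ℕ)
    (h : List (A × Y)) :
    histDist π obs' n h = histDist π obs n h * ENNReal.ofReal (Real.exp (-(h.map F).sum)) := by
  induction n generalizing h with
  | zero => by_cases hh : h = [] <;> simp [histDist, PMF.pure_apply, hh]
  | succ n ih =>
    match h with
    | [] => simp [histDist_succ_nil]
    | (a, y) :: h =>
      rw [histDist_succ_cons, histDist_succ_cons, ih, hF, List.map_cons, List.sum_cons, neg_add,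
        Real.exp_add, ENNReal.ofReal_mul (Real.exp_nonneg _)]
      ring

theorem hasSum_toReal_one {X : Type*} (p : PMF X) : HasSum (fun x => (p x).toReal) 1 := by
  have h := ENNReal.hasSum_toReal p.tsum_coe_ne_top
  rwa [← ENNReal.tsum_toReal_eq p.apply_ne_top, p.tsum_coe, ENNReal.toReal_one] at h

/-- A transportation inequality for a pair of laws with log-likelihood ratio `L`. -/
theorem mul_tsum_sub_exp_mul_tsum_le {X : Type*} {p q : PMF X} {L Z : X → ℝ} {l : ℝ}
    (hq : ∀ x, q x = p x * ENNReal.ofReal (Real.exp (-L x)))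
    (hL : HasSum (fun x => (p x).toReal * L x) l)
    (hp0 : ∀ x, p x ≠ 0 → 0 ≤ Z x) (hp1 : ∀ x, p x ≠ 0 → Z x ≤ 1) (s : ℝ) :
    s * ∑' x, (p x).toReal * Z x - Real.exp s * ∑' x, (q x).toReal * Z x ≤ l := by
  have hp := hasSum_toReal_one p
  have hq1 := hasSum_toReal_one q
  have hqp : ∀ x, (q x).toReal = (p x).toReal * Real.exp (-L x) := fun x => by
    rw [hq, ENNReal.toReal_mul, ENNReal.toReal_ofReal (Real.exp_nonneg _)]
  have sp : Summable fun x => (p x).toReal * Z x := by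
    refine Summable.of_norm_bounded hp.summable fun x => ?_
    by_cases hx : p x = 0
    · simp [hx]
    rw [Real.norm_eq_abs, abs_of_nonneg (mul_nonneg ENNReal.toReal_nonneg (hp0 x hx))]
    exact mul_le_of_le_one_right ENNReal.toReal_nonneg (hp1 x hx)
  have sq : Summable fun x => (q x).toReal * Z x := by
    refine Summable.of_norm_bounded hq1.summable fun x => ?_
    by_cases hx : p x = 0
    · simp [hqp, hx]
    rw [Real.norm_eq_abs, abs_of_nonneg (mul_nonneg ENNReal.toReal_nonneg (hp0 x hx))]
    exact mul_le_of_le_one_right ENNReal.toReal_nonneg (hp1 x hx)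
  have h1 := (sp.hasSum.mul_left s).sub hL
  have h2 := (hq1.add (sq.hasSum.mul_left (Real.exp s))).sub hp
  have := hasSum_le (fun x => ?_) h1 h2
  · linarith
  by_cases hx : p x = 0
  · simp [hqp, hx]
  have h0 := hp0 x hx
  have h1 := hp1 x hx
  -- Pointwise, `s Z - L + 1 ≤ exp (s Z - L) ≤ (1 + exp s * Z) * exp (-L)`; summing against `p`
  -- turns `exp (-L)` into the change of law to `q`.
  have e1 := Real.add_one_le_exp (s * Z x - L x)
  -- The chord of `exp (s ·)` over `[0, 1]`, with the term `-Z` dropped.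
  have e2 : Real.exp (s * Z x) ≤ 1 + Real.exp s * Z x := by
    have := convexOn_exp.2 (Set.mem_univ 0) (Set.mem_univ s) (sub_nonneg.2 h1) h0 (by ring)
    simp only [smul_eq_mul, mul_zero, zero_add, Real.exp_zero, mul_one] at this
    rw [mul_comm s]
    nlinarith
  have e3 : Real.exp (s * Z x - L x) ≤ (1 + Real.exp s * Z x) * Real.exp (-L x) := by
    rw [sub_eq_add_neg, Real.exp_add]
    gcongr
  rw [hqp]
  have := mul_le_mul_of_nonneg_left (e1.trans e3) (ENNReal.toReal_nonneg (a := p x))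
  linarith

end Interaction

/-! ### Poisson thinning and the law of one observation. -/

open scoped ENNReal

variable {K U : ℕ}

/-- Terms with `x < y` vanish; with `x = j + y` the rest is the exponential series of `l * (1 - p)`.
-/
theorem hasSum_poisson_mul_binomial (l p : ℝ) (y : ℕ) :
    HasSum (fun x : ℕ => Real.exp (-l) * l ^ x / x.factorial *
      (x.choose y * p ^ y * (1 - p) ^ (x - y)))
      (Real.exp (-(p * l)) * (p * l) ^ y / y.factorial) := by
  rw [← hasSum_nat_add_iff' y]
  rw [Finset.sum_eq_zero fun x hx => by simp [Nat.choose_eq_zero_of_lt (Finset.mem_range.1 hx)],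
    sub_zero]
  have h := (NormedSpace.expSeries_div_hasSum_exp (l * (1 - p))).mul_left
    (Real.exp (-l) * (p * l) ^ y / y.factorial)
  rw [← Real.exp_eq_exp_ℝ] at h
  convert! h using 1
  · ext j
    have hc : ((j + y).choose y : ℝ) * (j.factorial * y.factorial) = (j + y).factorial := by
      exact_mod_cast (by rw [← mul_assoc]; exact Nat.add_choose_mul_factorial_mul_factorial j y)
    have h1 : (j.factorial : ℝ) ≠ 0 := by positivity
    have h2 : (y.factorial : ℝ) ≠ 0 := by positivity
    have h3 : ((j + y).factorial : ℝ) ≠ 0 := by positivity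
    rw [Nat.add_sub_cancel, mul_pow l, mul_pow p]
    field_simp
    rw [← hc]
    ring
  · have hx : Real.exp (-(p * l)) = Real.exp (-l) * Real.exp (l * (1 - p)) := by
      rw [← Real.exp_add]; ring_nf
    rw [hx]
    ring

theorem hasSum_poisson_mul_id (l : ℝ) :
    HasSum (fun x : ℕ => Real.exp (-l) * l ^ x / x.factorial * x) l := by
  rw [← hasSum_nat_add_iff' 1]
  have h := (NormedSpace.expSeries_div_hasSum_exp l).mul_left (Real.exp (-l) * l)
  rw [← Real.exp_eq_exp_ℝ] at h
  convert! h using 1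
  · ext j
    rw [Nat.factorial_succ]
    push_cast
    field_simp
    ring
  · rw [mul_right_comm, ← Real.exp_add]
    simp

namespace Env

variable (e : Env K U) (φ : Scaling K U)

/-- The mean number of events observed in a cell. -/
def cellMean (a : Action K U) (k : Fin K) : ℝ := (e.gamma φ a k : ℝ) * (e.rate k : ℝ)

theorem cellMean_nonneg (a : Action K U) (k : Fin K) : 0 ≤ e.cellMean φ a k :=
  mul_nonneg (e.gamma φ a k).2.1 (e.rate k).2

theorem cellMean_of_eq_some {a : Action K U} {k : Fin K} {u : Fin U} (h : a.1 k = some u) :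
    e.cellMean φ a k = (φ u a : ℝ) * e.tau k u := by
  simp [cellMean, gamma, h, tau, mul_assoc]

theorem cellMean_of_eq_none {a : Action K U} {k : Fin K} (h : a.1 k = none) :
    e.cellMean φ a k = 0 := by
  simp [cellMean, gamma, h]

theorem cellMean_eq_sum (a : Action K U) (k : Fin K) :
    e.cellMean φ a k = ∑ u, filterVec φ a k u * e.tau k u := by
  cases h : a.1 k with
  | none => simp [cellMean_of_eq_none e φ h, filterVec, h]
  | some u => simp [cellMean_of_eq_some e φ h, filterVec, h]

theorem tau_pos (k : Fin K) (u : Fin U) : 0 < e.tau k u :=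
  mul_pos (e.base_pos k u) (e.rate_pos k)

/-- Thinning: the observed number of events in a cell has a Poisson law. -/
theorem cellLaw_apply (a : Action K U) (k : Fin K) (y : ℕ) :
    e.cellLaw φ a k y = ENNReal.ofReal
      (Real.exp (-e.cellMean φ a k) * e.cellMean φ a k ^ y / y.factorial) := by
  have h := hasSum_poisson_mul_binomial (e.rate k) (e.gamma φ a k) y
  have h1 : ∀ x : ℕ, 0 ≤ Real.exp (-(e.rate k : ℝ)) * (e.rate k : ℝ) ^ x / x.factorial :=
    fun x => by positivity
  rw [cellMean, ← h.tsum_eq, ENNReal.ofReal_tsum_of_nonneg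
    (fun x => mul_nonneg (h1 x) ProbabilityTheory.binomial_nonneg) h.summable, cellLaw,
    PMF.bind_apply]
  refine tsum_congr fun x => ?_
  rw [MeasureTheory.Measure.toPMF_apply, MeasureTheory.Measure.toPMF_apply,
    ProbabilityTheory.poissonMeasure_singleton, ProbabilityTheory.binomial_singleton,
    ENNReal.ofReal_mul (h1 x)]

theorem obsLaw_apply (a : Action K U) (y : Fin K → ℕ) :
    e.obsLaw φ a y = ∏ k, e.cellLaw φ a k (y k) := by
  rw [obsLaw, MeasureTheory.Measure.toPMF_apply, MeasureTheory.Measure.pi_singleton]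
  exact Finset.prod_congr rfl fun k _ =>
    PMF.toMeasure_apply_singleton _ _ (MeasurableSet.singleton _)

theorem hasSum_obsLaw_mul_eval (a : Action K U) (k : Fin K) :
    HasSum (fun y => (e.obsLaw φ a y).toReal * (y k : ℝ)) (e.cellMean φ a k) := by
  have h := hasSum_poisson_mul_id (e.cellMean φ a k)
  have hm := e.cellMean_nonneg φ a k
  have h1 : ∑' x : ℕ, e.cellLaw φ a k x * (x : ℝ≥0∞) = ENNReal.ofReal (e.cellMean φ a k) := by
    conv_rhs => rw [← h.tsum_eq, ENNReal.ofReal_tsum_of_nonneg (fun x => by positivity) h.summable]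
    refine tsum_congr fun x => ?_
    rw [cellLaw_apply, ENNReal.ofReal_mul (by positivity), ENNReal.ofReal_natCast]
  have h2 : ∑' y, e.obsLaw φ a y * (y k : ℝ≥0∞) = ENNReal.ofReal (e.cellMean φ a k) := by
    rw [← h1]
    have hl := (MeasureTheory.measurePreserving_eval
      (fun k => (e.cellLaw φ a k).toMeasure) k).lintegral_comp
      (f := fun n : ℕ => (n : ℝ≥0∞)) (Measurable.of_discrete)
    rw [MeasureTheory.lintegral_countable', MeasureTheory.lintegral_countable'] at hl
    have e1 : ∀ x : ℕ, (e.cellLaw φ a k).toMeasure {x} = e.cellLaw φ a k x := fun x =>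
      PMF.toMeasure_apply_singleton _ _ (MeasurableSet.singleton _)
    have e2 : ∀ y, MeasureTheory.Measure.pi (fun k => (e.cellLaw φ a k).toMeasure) {y} =
        e.obsLaw φ a y := fun _ => rfl
    simp only [e1, e2, Function.eval] at hl
    simpa only [mul_comm] using hl
  have h3 := ENNReal.hasSum_toReal (h2.trans_ne ENNReal.ofReal_ne_top)
  rw [← ENNReal.tsum_toReal_eq (ENNReal.ne_top_of_tsum_ne_top
    (h2.trans_ne ENNReal.ofReal_ne_top)), h2, ENNReal.toReal_ofReal hm] at h3
  simpa [ENNReal.toReal_mul] using h3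

end Env

/-- The log-likelihood ratio of the parameters `τ` and `θ` in a round. -/
def logRatio (φ : Scaling K U) (τ θ : Fin K → Fin U → ℝ) (x : Round K U) : ℝ :=
  ∑ k, ∑ u, ((if x.1.1 k = some u then (x.2 k : ℝ) else 0) * Real.log (τ k u / θ k u)
    - filterVec φ x.1 k u * (τ k u - θ k u))

namespace Env

variable (e : Env K U) (φ : Scaling K U)

theorem hasSum_obsLaw_mul_logRatio (θ : Fin K → Fin U → ℝ) (a : Action K U) :
    HasSum (fun y => (e.obsLaw φ a y).toReal * logRatio φ e.tau θ (a, y))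
      (info e.tau θ (filterVec φ a)) := by
  simp only [logRatio, info, Finset.mul_sum]
  refine hasSum_sum fun k _ => hasSum_sum fun u _ => ?_
  have h1 := hasSum_toReal_one (e.obsLaw φ a)
  by_cases h : a.1 k = some u
  · have h2 := ((e.hasSum_obsLaw_mul_eval φ a k).mul_right (Real.log (e.tau k u / θ k u))).sub
      (h1.mul_right (filterVec φ a k u * (e.tau k u - θ k u)))
    convert! h2 using 1
    · ext y; simp only [h, if_true]; ring
    · rw [cellMean_of_eq_some e φ h]
      simp only [filterVec, h, if_true, kl]
      ring
  · simp [filterVec, h, hasSum_zero]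

/-- In a cell searched by `u` the Poisson means are `φ τ` and `φ θ`, so the scaling cancels inside
the logarithm. The product form also covers `φ = 0`, where both laws sit at `0`. -/
theorem obsLaw_eq_mul_exp (e' : Env K U) (a : Action K U) (y : Fin K → ℕ) :
    e'.obsLaw φ a y = e.obsLaw φ a y *
      ENNReal.ofReal (Real.exp (-logRatio φ e.tau e'.tau (a, y))) := by
  rw [logRatio, ← Finset.sum_neg_distrib, Real.exp_sum,
    ENNReal.ofReal_prod_of_nonneg fun _ _ => Real.exp_nonneg _, obsLaw_apply, obsLaw_apply,
    ← Finset.prod_mul_distrib]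
  refine Finset.prod_congr rfl fun k _ => ?_
  rw [cellLaw_apply, cellLaw_apply]
  have hm := e.cellMean_nonneg φ a k
  rw [← ENNReal.ofReal_mul (by positivity)]
  congr 1
  cases h : a.1 k with
  | none => simp [cellMean_of_eq_none _ φ h, filterVec, h]
  | some u =>
    have ht := e.tau_pos k u
    have ht' := e'.tau_pos k u
    have hsum : ∑ v, ((if some u = some v then (y k : ℝ) else 0) *
        Real.log (e.tau k v / e'.tau k v) - filterVec φ a k v * (e.tau k v - e'.tau k v)) =
        y k * Real.log (e.tau k u / e'.tau k u) - φ u a * (e.tau k u - e'.tau k u) := by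
      rw [Finset.sum_eq_single u]
      · simp [filterVec, h]
      · intro v _ hv
        simp [filterVec, h, hv.symm]
      · simp
    rw [hsum, cellMean_of_eq_some _ φ h, cellMean_of_eq_some _ φ h, neg_sub, sub_eq_add_neg,
      Real.exp_add, ← mul_neg (y k : ℝ), ← Real.log_inv, inv_div, ← Real.log_pow,
      Real.exp_log (by positivity)]
    have hx : Real.exp (-(φ u a * e'.tau k u)) =
        Real.exp (-(φ u a * e.tau k u)) * Real.exp (φ u a * (e.tau k u - e'.tau k u)) := by
      rw [← Real.exp_add]; ring_nf
    rw [hx, div_pow, mul_pow, mul_pow]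
    field_simp

/-- An environment with prescribed positive products `ω_{ku} λ_k`. -/
def ofTau (θ : Fin K → Fin U → ℝ) (hθ : ∀ k u, 0 < θ k u) : Env K U where
  -- The sum dominates each `θ k u`, keeping the ratios at most 1; the extra `1` keeps the rate
  -- positive even without agents.
  rate k := (∑ u, θ k u + 1).toNNReal
  rate_pos k := Real.toNNReal_pos.2
    (add_pos_of_nonneg_of_pos (Finset.sum_nonneg fun u _ => (hθ k u).le) zero_lt_one)
  base k u := ⟨θ k u / (∑ v, θ k v + 1), by
    have h : ∀ v, 0 ≤ θ k v := fun v => (hθ k v).le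
    have hs := Finset.sum_nonneg fun v (_ : v ∈ Finset.univ) => h v
    have hle := Finset.single_le_sum (fun v _ => h v) (Finset.mem_univ u)
    exact ⟨div_nonneg (h u) (by linarith), div_le_one_of_le₀ (by linarith) (by linarith)⟩⟩
  base_pos k u := by
    have hs := Finset.sum_nonneg fun v (_ : v ∈ Finset.univ) => (hθ k v).le
    rw [← Subtype.coe_lt_coe]
    exact div_pos (hθ k u) (by linarith)

theorem tau_ofTau (θ : Fin K → Fin U → ℝ) (hθ : ∀ k u, 0 < θ k u) : (ofTau θ hθ).tau = θ := by
  ext k u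
  have hs := Finset.sum_nonneg fun v (_ : v ∈ Finset.univ) => (hθ k v).le
  simp only [tau, ofTau]
  rw [Real.coe_toNNReal _ (by linarith)]
  exact div_mul_cancel₀ _ (by linarith)

end Env

/-! ### Play counts, regret decomposition and change of measure. -/

open Filter Topology

namespace Env

variable (e : Env K U) (φ : Scaling K U) (π : Policy K U)

theorem histLaw_eq_histDist (n : ℕ) : e.histLaw φ π n = histDist π (e.obsLaw φ) n := by
  induction n with
  | zero => rfl
  | succ n ih => simp only [histLaw, histDist, ih]

theorem length_of_histLaw_ne_zero {n : ℕ} {h : List (Round K U)} (hh : e.histLaw φ π n h ≠ 0) :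
    h.length = n := by
  rw [histLaw_eq_histDist] at hh
  exact length_of_histDist_ne_zero _ _ hh

theorem hasSum_expSum (f : Action K U → ℝ) (n : ℕ) :
    HasSum (fun h => (e.histLaw φ π n h).toReal * (h.map fun x => f x.1).sum)
      (e.expSum φ π f n) := by
  rw [expSum, histLaw_eq_histDist]
  refine hasSum_histDist_mul_sum π (e.obsLaw φ) (F := fun x => f x.1) (m := f) (fun a => ?_) n
  simpa using (hasSum_toReal_one (e.obsLaw φ a)).mul_right (f a)

theorem hasSum_expSum_of_mean {F : Round K U → ℝ} {m : Action K U → ℝ}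
    (hF : ∀ a, HasSum (fun y => (e.obsLaw φ a y).toReal * F (a, y)) (m a)) (n : ℕ) :
    HasSum (fun h => (e.histLaw φ π n h).toReal * (h.map F).sum) (e.expSum φ π m n) := by
  rw [expSum, histLaw_eq_histDist]
  exact hasSum_histDist_mul_sum π (e.obsLaw φ) hF n

theorem expSum_const (c : ℝ) (n : ℕ) : e.expSum φ π (fun _ => c) n = n * c := by
  have h := (hasSum_toReal_one (e.histLaw φ π n)).mul_right (n * c)
  rw [one_mul] at h
  refine (e.hasSum_expSum φ π (fun _ => c) n).unique ?_
  convert! h using 1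
  ext l
  by_cases hl : e.histLaw φ π n l = 0
  · simp [hl]
  · simp [e.length_of_histLaw_ne_zero φ π hl]

theorem expSum_sum {ι : Type*} (s : Finset ι) (c : ι → ℝ) (f : ι → Action K U → ℝ) (n : ℕ) :
    e.expSum φ π (fun a => ∑ i ∈ s, c i * f i a) n = ∑ i ∈ s, c i * e.expSum φ π (f i) n := by
  have h := hasSum_sum fun i (_ : i ∈ s) => (e.hasSum_expSum φ π (f i) n).mul_left (c i)
  refine (e.hasSum_expSum φ π _ n).unique ?_
  convert! h using 1
  ext l
  have hl : (l.map fun x => ∑ i ∈ s, c i * f i x.1).sum =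
      ∑ i ∈ s, c i * (l.map fun x => f i x.1).sum := by
    induction l with
    | nil => simp
    | cons x l ih => simp only [List.map_cons, List.sum_cons, ih, mul_add, Finset.sum_add_distrib]
  rw [hl, Finset.mul_sum]
  exact Finset.sum_congr rfl fun i _ => by ring

open Classical in
/-- The expected number of rounds in which `g` is played. -/
def playCount (g : Fin K → Fin U → ℝ) (n : ℕ) : ℝ :=
  e.expSum φ π (fun a => if filterVec φ a = g then 1 else 0) n

theorem playCount_nonneg (g : Fin K → Fin U → ℝ) (n : ℕ) : 0 ≤ e.playCount φ π g n := by
  refine tsum_nonneg fun h => mul_nonneg ENNReal.toReal_nonneg (List.sum_nonneg ?_)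
  simp only [List.mem_map]
  rintro _ ⟨x, -, rfl⟩
  split_ifs <;> norm_num

end Env

theorem filterVec_mem (φ : Scaling K U) (a : Action K U) : filterVec φ a ∈ filterVecs φ := by
  simp [filterVecs]

theorem filterVec_nonneg (φ : Scaling K U) (a : Action K U) (k : Fin K) (u : Fin U) :
    0 ≤ filterVec φ a k u := by
  unfold filterVec
  split_ifs
  exacts [(φ u a).2.1, le_rfl]

theorem gap_nonneg {φ : Scaling K U} {g : Fin K → Fin U → ℝ} (hg : g ∈ filterVecs φ)
    (τ : Fin K → Fin U → ℝ) : 0 ≤ gap φ τ g := by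
  obtain ⟨a, rfl⟩ : ∃ a, filterVec φ a = g := by simpa [filterVecs] using hg
  exact sub_nonneg.2 (le_ciSup (f := fun a => value τ (filterVec φ a)) (Set.finite_range _).bddAbove a)

theorem gap_of_mem_optimal {φ : Scaling K U} {τ g : Fin K → Fin U → ℝ} (hg : g ∈ optimal φ τ) :
    gap φ τ g = 0 :=
  sub_eq_zero.2 (Finset.mem_filter.1 hg).2.symm

theorem gap_pos {φ : Scaling K U} {τ g : Fin K → Fin U → ℝ} (hg : g ∈ suboptimal φ τ) :
    0 < gap φ τ g := by
  classical
  obtain ⟨h1, h2⟩ := Finset.mem_sdiff.1 hg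
  refine (gap_nonneg h1 τ).lt_of_ne fun h => h2 (Finset.mem_filter.2 ⟨h1, ?_⟩)
  exact (sub_eq_zero.1 h.symm).symm

theorem sum_suboptimal_add_sum_optimal (φ : Scaling K U) (τ : Fin K → Fin U → ℝ)
    (f : (Fin K → Fin U → ℝ) → ℝ) :
    ∑ g ∈ suboptimal φ τ, f g + ∑ g ∈ optimal φ τ, f g = ∑ g ∈ filterVecs φ, f g := by
  classical
  exact Finset.sum_sdiff (Finset.filter_subset _ _)

/-- Alternatives agree with `τ` wherever `g` has positive weight, and `kl x x = 0`: optimal plays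
cannot tell them apart. -/
theorem info_eq_zero {φ : Scaling K U} {τ θ g : Fin K → Fin U → ℝ} (hτ : ∀ k u, 0 < τ k u)
    (hθ : θ ∈ altSet φ τ) (hg : g ∈ optimal φ τ) : info τ θ g = 0 := by
  obtain ⟨a, rfl⟩ : ∃ a, filterVec φ a = g := by
    simpa [filterVecs] using (Finset.mem_filter.1 hg).1
  refine Finset.sum_eq_zero fun k _ => Finset.sum_eq_zero fun u _ => ?_
  rcases (filterVec_nonneg φ a k u).eq_or_lt with h | h
  · rw [← h, zero_mul]
  · rw [hθ.2.2 (k, u) ⟨_, hg, h⟩, kl, div_self (hτ k u).ne']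
    simp

namespace Env

variable (e : Env K U) (φ : Scaling K U) (π : Policy K U)

theorem expSum_filterVec (F : (Fin K → Fin U → ℝ) → ℝ) (n : ℕ) :
    e.expSum φ π (fun a => F (filterVec φ a)) n = ∑ g ∈ filterVecs φ, F g * e.playCount φ π g n := by
  classical
  simp only [playCount]
  rw [← expSum_sum]
  congr 1
  ext a
  simp [filterVec_mem]

theorem sum_playCount (n : ℕ) : ∑ g ∈ filterVecs φ, e.playCount φ π g n = n := by
  have h := e.expSum_filterVec φ π (fun _ => 1) n
  rw [expSum_const] at h
  simpa using h.symm

theorem reward_eq_value (a : Action K U) : e.reward φ a = value e.tau (filterVec φ a) :=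
  Finset.sum_congr rfl fun k _ => e.cellMean_eq_sum φ a k

theorem regret_eq_sum (n : ℕ) :
    e.regret φ π n = ∑ g ∈ suboptimal φ e.tau, gap φ e.tau g * e.playCount φ π g n := by
  have h : e.regret φ π n = ∑ g ∈ filterVecs φ, gap φ e.tau g * e.playCount φ π g n := by
    have hr : e.reward φ = fun a => value e.tau (filterVec φ a) :=
      funext fun a => e.reward_eq_value φ a
    rw [regret, hr, e.expSum_filterVec φ π (value e.tau), ← e.sum_playCount φ π, Finset.sum_mul,
      ← Finset.sum_sub_distrib]
    exact Finset.sum_congr rfl fun g _ => by rw [gap, opt]; ring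
  rw [h, ← sum_suboptimal_add_sum_optimal φ e.tau,
    Finset.sum_eq_zero (s := optimal φ e.tau) fun g hg => by rw [gap_of_mem_optimal hg, zero_mul],
    add_zero]

/-- The information gathered from suboptimal plays under `e` controls how differently the optimal
actions of `e` can be played under `e'`. -/
theorem le_sum_playCount_mul_info (e' : Env K U) (he' : e'.tau ∈ altSet φ e.tau) {n : ℕ}
    (hn : 0 < n) (s : ℝ) :
    s * (1 - (∑ g ∈ suboptimal φ e.tau, e.playCount φ π g n) / n) -
        Real.exp s * ((∑ g ∈ optimal φ e.tau, e'.playCount φ π g n) / n) ≤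
      ∑ g ∈ suboptimal φ e.tau, e.playCount φ π g n * info e.tau e'.tau g := by
  classical
  have hn' : (0 : ℝ) < n := by exact_mod_cast hn
  have hL := e.hasSum_expSum_of_mean φ π (fun a => e.hasSum_obsLaw_mul_logRatio φ e'.tau a) n
  rw [e.expSum_filterVec φ π (info e.tau e'.tau), ← sum_suboptimal_add_sum_optimal φ e.tau,
    Finset.sum_eq_zero (s := optimal φ e.tau) fun g hg => by
      rw [info_eq_zero e.tau_pos he' hg, zero_mul], add_zero] at hL
  set J : Action K U → ℝ := fun a => if filterVec φ a ∈ optimal φ e.tau then 1 else 0 with hJ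
  have hJsum : ∀ f : Env K U, f.expSum φ π J n = ∑ g ∈ optimal φ e.tau, f.playCount φ π g n := by
    intro f
    rw [hJ, f.expSum_filterVec φ π fun g => if g ∈ optimal φ e.tau then 1 else 0,
      ← sum_suboptimal_add_sum_optimal φ e.tau, Finset.sum_eq_zero (s := suboptimal φ e.tau),
      zero_add]
    · exact Finset.sum_congr rfl fun g hg => by rw [if_pos hg, one_mul]
    · intro g hg
      rw [if_neg (Finset.mem_sdiff.1 hg).2, zero_mul]
  have hZ : ∀ f : Env K U, ∑' h, (f.histLaw φ π n h).toReal *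
      ((h.map fun x => J x.1).sum / n) = (∑ g ∈ optimal φ e.tau, f.playCount φ π g n) / n := by
    intro f
    rw [← hJsum, ← ((f.hasSum_expSum φ π J n).div_const (n : ℝ)).tsum_eq]
    simp only [mul_div_assoc]
  have hq : ∀ h, e'.histLaw φ π n h = e.histLaw φ π n h *
      ENNReal.ofReal (Real.exp (-(h.map (logRatio φ e.tau e'.tau)).sum)) := by
    intro h
    rw [histLaw_eq_histDist, histLaw_eq_histDist]
    exact histDist_eq_mul_exp π _ (e.obsLaw_eq_mul_exp φ e') n h
  have hJ0 : ∀ a, 0 ≤ J a := fun a => by simp only [hJ]; split_ifs <;> norm_num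
  have hJ1 : ∀ a, J a ≤ 1 := fun a => by simp only [hJ]; split_ifs <;> norm_num
  -- The test statistic `Z` is the fraction of rounds in which an action optimal for `e` is played.
  have key := mul_tsum_sub_exp_mul_tsum_le hq hL
    (Z := fun h => (h.map fun x => J x.1).sum / n) ?_ ?_ s
  · rw [hZ, hZ] at key
    have h1 := sum_suboptimal_add_sum_optimal φ e.tau fun g => e.playCount φ π g n
    rw [sum_playCount] at h1
    have h2 : 1 - (∑ g ∈ suboptimal φ e.tau, e.playCount φ π g n) / n =
        (∑ g ∈ optimal φ e.tau, e.playCount φ π g n) / n := by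
      field_simp
      linarith
    rw [h2]
    simpa only [mul_comm] using key
  · intro h _
    refine div_nonneg (List.sum_nonneg ?_) hn'.le
    simp only [List.mem_map]
    rintro _ ⟨x, -, rfl⟩
    exact hJ0 _
  · intro h hh
    rw [div_le_one hn']
    have := List.sum_le_card_nsmul (h.map fun x => J x.1) 1 (by
      simp only [List.mem_map]
      rintro _ ⟨x, -, rfl⟩
      exact hJ1 _)
    simpa [e.length_of_histLaw_ne_zero φ π hh] using this

end Env

theorem UniformlyGood.tendsto {φ : Scaling K U} {π : Policy K U} (hπ : UniformlyGood φ π)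
    (e : Env K U) {g : Fin K → Fin U → ℝ} (hg : g ∈ filterVecs φ) (hgap : 0 < gap φ e.tau g)
    {α : ℝ} (hα : 0 < α) :
    Tendsto (fun n : ℕ => e.playCount φ π g n / (n : ℝ) ^ α) atTop (𝓝 0) :=
  (hπ e g hg hgap α hα).tendsto_div_nhds_zero

/-- If along an ultrafilter the normalised play counts of a uniformly good policy converge, then
the limit collects at least one unit of information against each alternative. -/
theorem UniformlyGood.one_le_sum {φ : Scaling K U} {π : Policy K U} (hπ : UniformlyGood φ π)
    (e : Env K U) {θ : Fin K → Fin U → ℝ} (hθ : θ ∈ altSet φ e.tau) {l : Filter ℕ} [l.NeBot]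
    (hl : l ≤ atTop) {d : (Fin K → Fin U → ℝ) → ℝ}
    (hd : ∀ g ∈ suboptimal φ e.tau,
      Tendsto (fun n : ℕ => e.playCount φ π g n / Real.log n) l (𝓝 (d g))) :
    1 ≤ ∑ g ∈ suboptimal φ e.tau, d g * info e.tau θ g := by
  classical
  obtain ⟨e', rfl⟩ : ∃ e' : Env K U, e'.tau = θ := ⟨_, Env.tau_ofTau θ hθ.1⟩
  have main : ∀ α : ℝ, 0 < α →
      1 - α ≤ ∑ g ∈ suboptimal φ e.tau, d g * info e.tau e'.tau g := by
    intro α hα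
    have h1 : Tendsto (fun n : ℕ => (∑ g ∈ suboptimal φ e.tau, e.playCount φ π g n) / (n : ℝ))
        atTop (𝓝 0) := by
      have := tendsto_finsetSum (suboptimal φ e.tau) fun g hg =>
        hπ.tendsto e (Finset.mem_sdiff.1 hg).1 (gap_pos hg) one_pos
      simpa [Finset.sum_div] using this
    have h2 : Tendsto (fun n : ℕ => (∑ g ∈ optimal φ e.tau, e'.playCount φ π g n) / (n : ℝ) ^ α)
        atTop (𝓝 0) := by
      have := tendsto_finsetSum (optimal φ e.tau) fun g hg =>
        hπ.tendsto e' (Finset.mem_filter.1 hg).1 (sub_pos.2 (hθ.2.1 g hg)) hα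
      simpa [Finset.sum_div] using this
    have hlog : Tendsto (fun n : ℕ => Real.log n) atTop atTop :=
      Real.tendsto_log_atTop.comp tendsto_natCast_atTop_atTop
    have h3 : Tendsto (fun n : ℕ =>
        (1 - α) * (1 - (∑ g ∈ suboptimal φ e.tau, e.playCount φ π g n) / (n : ℝ)) -
          (∑ g ∈ optimal φ e.tau, e'.playCount φ π g n) / (n : ℝ) ^ α / Real.log n)
        atTop (𝓝 (1 - α)) := by
      simpa using ((h1.const_sub 1).const_mul (1 - α)).sub (h2.div_atTop hlog)
    have h4 := tendsto_finsetSum (suboptimal φ e.tau) fun g hg =>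
      (hd g hg).mul_const (info e.tau e'.tau g)
    refine le_of_tendsto_of_tendsto (h3.mono_left hl) h4 (hl ?_)
    filter_upwards [eventually_gt_atTop 0, hlog.eventually_gt_atTop 0] with n hn hln
    have hn' : (0 : ℝ) < n := by exact_mod_cast hn
    -- With `s = (1 - α) log n`, `exp s / n = n ^ (-α)`, exactly the rate that uniform goodness
    -- under `e'` beats.
    have key := e.le_sum_playCount_mul_info φ π e' hθ hn ((1 - α) * Real.log n)
    have hexp : Real.exp ((1 - α) * Real.log n) = n / (n : ℝ) ^ α := by
      rw [mul_comm, ← Real.rpow_def_of_pos hn', Real.rpow_sub hn', Real.rpow_one]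
    rw [hexp] at key
    have := div_le_div_of_nonneg_right key hln.le
    convert! this using 1
    · field_simp
    · rw [Finset.sum_div]
      exact Finset.sum_congr rfl fun g _ => by ring
  refine le_of_forall_pos_le_add fun α hα => ?_
  linarith [main α hα]

end Surveillance

end

theorem corollary2 {K U : ℕ} (φ : Surveillance.Scaling K U) (e : Surveillance.Env K U)
    (hB : (Surveillance.altSet φ e.tau).Nonempty)
    (π : Surveillance.Policy K U) (hπ : Surveillance.UniformlyGood φ π) :
    Surveillance.lowerConst φ e.tau ≤
      Filter.liminf (fun n : ℕ => ((e.regret φ π n / Real.log n : ℝ) : EReal)) Filter.atTop := by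
  classical
  open Surveillance Filter Topology in
  by_contra! hlt
  obtain ⟨c, hc1, hc2⟩ := EReal.lt_iff_exists_real_btwn.1 hlt
  have hfreq : ∃ᶠ n : ℕ in atTop, e.regret φ π n / Real.log n < c :=
    (frequently_lt_of_liminf_lt (by isBoundedDefault) hc1).mono fun n hn => EReal.coe_lt_coe_iff.1 hn
  have hne : (atTop ⊓ 𝓟 {n : ℕ | e.regret φ π n / Real.log n < c}).NeBot :=
    frequently_mem_iff_neBot.1 hfreq
  -- Along an ultrafilter all bounded ratios converge at once, replacing successive extraction of
  -- subsequences.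
  set F := Ultrafilter.of (atTop ⊓ 𝓟 {n : ℕ | e.regret φ π n / Real.log n < c})
  have hF := Ultrafilter.of_le (atTop ⊓ 𝓟 {n : ℕ | e.regret φ π n / Real.log n < c})
  have hFtop : (F : Filter ℕ) ≤ atTop := hF.trans inf_le_left
  have hFc : ∀ᶠ n in (F : Filter ℕ), e.regret φ π n / Real.log n < c :=
    le_principal_iff.1 (hF.trans inf_le_right)
  have hFlog : ∀ᶠ n : ℕ in (F : Filter ℕ), 0 < Real.log n :=
    hFtop ((Real.tendsto_log_atTop.comp tendsto_natCast_atTop_atTop).eventually_gt_atTop 0)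
  have hlim : ∀ g ∈ suboptimal φ e.tau, ∃ x : ℝ, 0 ≤ x ∧
      Tendsto (fun n : ℕ => e.playCount φ π g n / Real.log n) F (𝓝 x) := by
    intro g hg
    -- Each term gap times count is at most the regret, which is below `c log n` along `F`.
    have hmem : (F.map fun n : ℕ => e.playCount φ π g n / Real.log n : Filter ℝ) ≤
        𝓟 (Set.Icc 0 (c / gap φ e.tau g)) := by
      rw [le_principal_iff]
      change ∀ᶠ n in (F : Filter ℕ), _
      filter_upwards [hFc, hFlog] with n hn hln
      refine ⟨div_nonneg (e.playCount_nonneg φ π g n) hln.le, ?_⟩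
      rw [le_div_iff₀ (gap_pos hg)]
      refine le_trans ?_ hn.le
      rw [div_mul_eq_mul_div, mul_comm, e.regret_eq_sum]
      gcongr
      exact Finset.single_le_sum (f := fun g => gap φ e.tau g * e.playCount φ π g n)
        (fun g hg => mul_nonneg (gap_pos hg).le (e.playCount_nonneg φ π g n)) hg
    obtain ⟨x, hx, hFx⟩ := isCompact_Icc.ultrafilter_le_nhds _ hmem
    exact ⟨x, hx.1, hFx⟩
  choose! d hd0 hd using hlim
  set d' : (Fin K → Fin U → ℝ) → ℝ := fun g => if g ∈ suboptimal φ e.tau then d g else 0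
  have hd' : ∀ g ∈ suboptimal φ e.tau, d' g = d g := fun g hg => if_pos hg
  have hfeas : d' ∈ feasible φ e.tau := by
    refine ⟨fun g => ?_, fun θ hθ => ?_⟩
    · by_cases hg : g ∈ suboptimal φ e.tau
      · rw [hd' g hg]; exact hd0 g hg
      · simp [d', hg]
    · exact hπ.one_le_sum e hθ hFtop fun g hg => by rw [hd' g hg]; exact hd g hg
  have hcost : ∑ g ∈ suboptimal φ e.tau, d' g * gap φ e.tau g ≤ c := by
    have h := tendsto_finsetSum (suboptimal φ e.tau) fun g hg =>
      (hd g hg).mul_const (gap φ e.tau g)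
    rw [Finset.sum_congr rfl fun g hg => by rw [hd' g hg]]
    refine le_of_tendsto h (hFc.mono fun n hn => ?_)
    refine le_trans (le_of_eq ?_) hn.le
    rw [e.regret_eq_sum, Finset.sum_div]
    exact Finset.sum_congr rfl fun g _ => by ring
  exact absurd (hc2.trans_le (iInf₂_le d' hfeas)) (not_lt.2 (EReal.coe_le_coe_iff.2 hcost))
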